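/- Let $n\ge 1$ and let $H$ be a connected loopless graph (multiple edges allowed) on the vertex set $[n+1]=\{1,\dots,n+1\}$ with finite edge multiset $E$; each edge is written $(i,j)$ with $i<j$ and is regarded as directed from $i$ to $j$. Let $\mathrm{indeg}_H(v)$ be the number of edges of the form $(\cdot,v)$, and assume that every intermediate vertex $v\in\{2,\dots,n\}$ has at least one incoming edge $(\cdot,v)$ and at least one outgoing edge $(v,\cdot)$. For $\mathbf a\in\mathbb Z^{n+1}$ let $$\mathcal F_H(\mathbf a)=\Big\{f\in\mathbb R_{\ge 0}^{E}\ :\ \sum_{e=(i,j)\in E}f(e)\,(\mathbf e_i-\mathbf e_j)=\mathbf a\Big\}$$ be the flow polytope of $H$ with netflow $\mathbf a$, and let $$K_H(\mathbf a)=\#\Big\{b\in\mathbb Z_{\ge 0}^{E}\ :\ \sum_{e=(i,j)\in E}b(e)\,(\mathbf e_i-\mathbf e_j)=\mathbf a\Big\}$$ be the Kostant partition function of $H$. For a lattice polytope $P\subset\mathbb R^{E}$ of dimension $d$, its normalized volume $\mathrm{vol}(P)$ is $d!$ times its $d$-dimensional volume, scaled so that a fundamental domain of the lattice of integer points in the linear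 direction space of the affine hull of $P$ has volume $1$. Put $d_i=\mathrm{indeg}_H(i)-1$ for $i\in\{2,\dots,n\}$. Then $$\mathrm{vol}\big(\mathcal F_H(1,0,\dots,0,-1)\big)=K_H\Big(0,d_2,\dots,d_n,-\sum_{i=2}^{n}d_i\Big).$$ -/

import Mathlib

/-!
# Flow polytopes, Kostant partition functions and normalized volumes

The vertex set `[n+1] = {1, …, n+1}` is modelled by `Fin (n + 1)`: vertex `1` is `0` and vertex
`n + 1` is `Fin.last n`, so the intermediate vertices `2, …, n` are those `i` with
`0 < i` and `i < Fin.last n`.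
-/

noncomputable section

/-- A loopless (signless) multigraph on the vertex set `[n+1]` whose edges are labelled by `E`.
Every edge has a smaller (initial) and a bigger (final) endpoint, which are distinct because
there are no loops; multiple edges are allowed. -/
structure LooplessGraph (n : ℕ) (E : Type*) where
  /-- the smaller endpoint of an edge -/
  init : E → Fin (n + 1)
  /-- the bigger endpoint of an edge -/
  fin : E → Fin (n + 1)
  init_lt_fin : ∀ e, init e < fin e

namespace LooplessGraph

/-- The graph is connected: its underlying simple graph is connected. -/
def Connected {n : ℕ} {E : Type*} (H : LooplessGraph n E) : Prop :=
  (SimpleGraph.fromRel fun u v => ∃ e, H.init e = u ∧ H.fin e = v).Connected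

/-- The indegree of `i`: the number of edges whose bigger endpoint is `i`. -/
def indeg {n : ℕ} {E : Type*} [Fintype E] (H : LooplessGraph n E) (i : Fin (n + 1)) : ℕ :=
  (Finset.univ.filter fun e => H.fin e = i).card

/-- The outdegree of `i`: the number of edges whose smaller endpoint is `i`. -/
def outdeg {n : ℕ} {E : Type*} [Fintype E] (H : LooplessGraph n E) (i : Fin (n + 1)) : ℕ :=
  (Finset.univ.filter fun e => H.init e = i).card

/-- The positive root `e_i - e_j` of type `A_n` that belongs to an edge `(i, j)`, `i < j`. -/
def root {n : ℕ} {E : Type*} (H : LooplessGraph n E) (e : E) : Fin (n + 1) → ℤ :=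
  Pi.single (H.init e) 1 - Pi.single (H.fin e) 1

/-- The flow polytope `F_H(a) ⊆ ℝ^E`: all nonnegative real flows on the edges with netflow `a`. -/
def flowPolytope {n : ℕ} {E : Type*} [Fintype E] (H : LooplessGraph n E)
    (a : Fin (n + 1) → ℤ) : Set (E → ℝ) :=
  {f | (∀ e, 0 ≤ f e) ∧ ∀ v, ∑ e, f e * (H.root e v : ℝ) = (a v : ℝ)}

/-- The families of nonnegative integers `b` with `∑ e, b e • root e = a`. -/
def kostantSet {n : ℕ} {E : Type*} [Fintype E] (H : LooplessGraph n E)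
    (a : Fin (n + 1) → ℤ) : Set (E → ℕ) :=
  {b | ∑ e, b e • H.root e = a}

/-- The number of ways of writing `a` is finite, so that its `Set.ncard` is a true count. -/
theorem kostantSet_finite {n : ℕ} {E : Type*} [Fintype E] (H : LooplessGraph n E)
    (a : Fin (n + 1) → ℤ) : (H.kostantSet a).Finite := by
  classical
  set c : ℤ := ∑ v : Fin (n + 1), -(v.val : ℤ) * a v with hc
  refine (Set.finite_Iic (fun _ : E => c.toNat)).subset ?_
  intro b hb e
  have hb' : ∑ e, b e • H.root e = a := hb
  have hroot : ∀ e, ∑ v : Fin (n + 1), -(v.val : ℤ) * H.root e v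
      = (H.fin e).val - (H.init e).val := by
    intro e
    simp [root, mul_sub, Finset.sum_sub_distrib, Pi.single_apply]
    ring
  have h1 : c = ∑ e, (b e : ℤ) * ((H.fin e).val - (H.init e).val) := by
    rw [hc, ← hb']
    simp only [Finset.sum_apply, Pi.smul_apply, Finset.mul_sum]
    rw [Finset.sum_comm]
    refine Finset.sum_congr rfl fun e _ => ?_
    rw [← hroot e, Finset.mul_sum]
    refine Finset.sum_congr rfl fun v _ => ?_
    rw [nsmul_eq_mul]
    ring
  have hpos : ∀ e, (1 : ℤ) ≤ (H.fin e).val - (H.init e).val := by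
    intro e
    have := H.init_lt_fin e
    rw [Fin.lt_def] at this
    omega
  have h2 : (b e : ℤ) ≤ c := by
    rw [h1]
    calc (b e : ℤ) ≤ (b e : ℤ) * ((H.fin e).val - (H.init e).val) :=
          le_mul_of_one_le_right (by positivity) (hpos e)
      _ ≤ _ := Finset.single_le_sum
          (f := fun e => (b e : ℤ) * ((H.fin e).val - (H.init e).val))
          (fun i _ => mul_nonneg (by positivity) (by linarith [hpos i])) (Finset.mem_univ e)
  show b e ≤ c.toNat
  omega

/-- The Kostant partition function `K_H(a)`: the number of ways of writing `a` as a combination,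
with nonnegative integer coefficients, of the roots that belong to the edges of `H`. -/
def kostant {n : ℕ} {E : Type*} [Fintype E] (H : LooplessGraph n E)
    (a : Fin (n + 1) → ℤ) : ℕ :=
  (H.kostantSet a).ncard

/-- The integer `d_i = indeg_H(i) - 1`. -/
def shiftedIndeg {n : ℕ} {E : Type*} [Fintype E] (H : LooplessGraph n E)
    (i : Fin (n + 1)) : ℤ :=
  (H.indeg i : ℤ) - 1

/-- The vector `(0, d_2, …, d_n, -(d_2 + ⋯ + d_n))`. -/
def indegVector {n : ℕ} {E : Type*} [Fintype E] (H : LooplessGraph n E) : Fin (n + 1) → ℤ :=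
  fun v =>
    if v = 0 then 0
    else if v = Fin.last n then -∑ i ∈ Finset.Ioo 0 (Fin.last n), H.shiftedIndeg i
    else H.shiftedIndeg v

end LooplessGraph

/-- The netflow vector `(1, 0, …, 0, -1)`. -/
def unitNetflow (n : ℕ) : Fin (n + 1) → ℤ :=
  Pi.single 0 1 - Pi.single (Fin.last n) 1

/-- The integer points of a linear subspace `V` of `ℝ^E`. -/
def integerLattice {E : Type*} (V : Submodule ℝ (E → ℝ)) : Submodule ℤ V where
  carrier := {v | ∀ e, ∃ k : ℤ, (v : E → ℝ) e = k}
  zero_mem' := fun e => ⟨0, by simp⟩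
  add_mem' := by
    intro v w hv hw e
    obtain ⟨k, hk⟩ := hv e
    obtain ⟨l, hl⟩ := hw e
    exact ⟨k + l, by simp [hk, hl]⟩
  smul_mem' := by
    intro c v hv e
    obtain ⟨k, hk⟩ := hv e
    exact ⟨c * k, by simp [hk]⟩

/-- The normalized volume of a lattice polytope `P` in `ℝ^E`. Let `V` be the direction of the
affine span of `P` and let `d` be its dimension (the dimension of `P`). Translate `P` into `V` by
one of its points; the normalized volume is `d!` times the volume of the translate, measured
relative to the lattice of integer points of `V`, so that a unimodular `d`-simplex has normalized
volume `1`. The quotient of the volume by the covolume of the lattice does not depend on the choice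
of a Haar measure on `V`, nor on the point of `P`. The empty polytope has volume `0`. -/
def normalizedVolume {E : Type*} [Fintype E] (P : Set (E → ℝ)) : ℝ :=
  open Classical in
  if h : P.Nonempty then
    let V : Submodule ℝ (E → ℝ) := vectorSpan ℝ P
    let μ : MeasureTheory.Measure V := MeasureTheory.Measure.addHaar
    ((Module.finrank ℝ V).factorial : ℝ) *
      (μ.real {v : V | h.some + (v : E → ℝ) ∈ P} / ZLattice.covolume (integerLattice V) μ)
  else 0

end

/-! Put `d = |E| - n`, the dimension of the polytope. The lattice points of its `t`-th dilate are
the natural flows of size `t`, so there are asymptotically `vol * t ^ d / d!` of them, and it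
suffices to show that their number is also asymptotic to `K * t ^ d / d!`, where `K` is the Kostant
number.

To see this, cut the graph after a vertex and give each crossing edge with flow `f` a weight `f ^ b
/ b!`. Moving the cut past the next vertex takes two steps. Integrating over all ways to split a
total `x` among its incoming edges gives `x ^ N / N!` with `N = ∑ b + indeg - 1` (Dirichlet's
integral). Since `x` is the sum of the outgoing flows, the multinomial theorem then distributes `N`
as exponents over the outgoing edges. This is the Kostant condition at that vertex. All exponents
are `0` at the source, and each family counted by `K` contributes `t ^ d / d!` at the sink.

For integer flows, the weights `(b + x).choose b` and `x.choose b` obey both steps up to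
inequalities, in opposite directions. `mixedSum_rel_succ` moves the cut, `card_flowLevel_rel` bounds
the number of flows between `K * t.choose d` and `K * (d + t).choose d`, and
`ZLattice.tendsto_card_div_pow_of_convex` turns the count into a volume. -/

section

open Finset

/-! ### Vandermonde identities and discrete divided powers -/

/-- Vandermonde's identity for the coefficients of the powers of a power series. -/
theorem PowerSeries.sum_piAntidiag_prod_coeff_pow {R ι : Type*} [CommSemiring R] [DecidableEq ι]
    (u : PowerSeries R) (s : Finset ι) (m : ι → ℕ) (k : ℕ) :
    ∑ c ∈ s.piAntidiag k, ∏ i ∈ s, PowerSeries.coeff (c i) (u ^ m i)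
      = PowerSeries.coeff k (u ^ ∑ i ∈ s, m i) := by
  rw [← prod_pow_eq_pow_sum, PowerSeries.coeff_prod]
  refine (sum_bij (fun (l : ι →₀ ℕ) _ => (l : ι → ℕ)) ?_ ?_ ?_ ?_).symm
  · intro l hl
    rw [mem_finsuppAntidiag] at hl
    rw [mem_piAntidiag]
    exact ⟨hl.1, fun i hi => hl.2 (Finsupp.mem_support_iff.2 hi)⟩
  · intro l _ l' _ h
    exact DFunLike.coe_injective h
  · intro c hc
    rw [mem_piAntidiag] at hc
    exact ⟨Finsupp.onFinset s c hc.2, by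
      rw [mem_finsuppAntidiag]
      exact ⟨hc.1, Finsupp.support_onFinset_subset⟩, rfl⟩
  · intro l _
    rfl

/-- Vandermonde's identity for finitely many summands. -/
theorem Finset.sum_piAntidiag_prod_choose {ι : Type*} [DecidableEq ι] (s : Finset ι) (m : ι → ℕ)
    (k : ℕ) : ∑ c ∈ s.piAntidiag k, ∏ i ∈ s, (m i).choose (c i) = (∑ i ∈ s, m i).choose k := by
  have h := PowerSeries.sum_piAntidiag_prod_coeff_pow
    (((1 + Polynomial.X : Polynomial ℕ)) : PowerSeries ℕ) s m k
  simpa only [← Polynomial.coe_pow, Polynomial.coeff_coe, Polynomial.coeff_one_add_X_pow,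
    Nat.cast_id] using h

/-- Vandermonde's identity for multiset coefficients. -/
theorem Finset.sum_piAntidiag_prod_choose_add {ι : Type*} [DecidableEq ι] {s : Finset ι}
    (hs : s.Nonempty) (a : ι → ℕ) (k : ℕ) :
    ∑ c ∈ s.piAntidiag k, ∏ i ∈ s, (a i + c i).choose (a i)
      = (∑ i ∈ s, a i + #s - 1 + k).choose (∑ i ∈ s, a i + #s - 1) := by
  -- The series is `1 / (1 - X)`, whose power `a + 1` has the coefficients `(a + k).choose a`.
  have h := PowerSeries.sum_piAntidiag_prod_coeff_pow
    (PowerSeries.mk 1 : PowerSeries ℤ) s (fun i => a i + 1) k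
  have hc : ∑ i ∈ s, (a i + 1) = (∑ i ∈ s, a i + #s - 1) + 1 := by
    have := hs.card_pos
    simp only [sum_add_distrib, sum_const, smul_eq_mul, mul_one]
    omega
  rw [hc] at h
  simp only [PowerSeries.mk_one_pow_eq_mk_choose_add, PowerSeries.coeff_mk] at h
  exact_mod_cast h

/-- A weight `φ` that behaves, up to the relation `r`, like the divided power
`φ b x = x ^ b / b!`: integration over a dilated simplex and expansion of a power of a sum. -/
structure IsDividedPowerWeight (ι : Type*) [DecidableEq ι] (r : ℕ → ℕ → Prop)
    (φ : ℕ → ℕ → ℕ) : Prop where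
  zero_left : ∀ x, φ 0 x = 1
  integrate : ∀ {s : Finset ι} (_ : s.Nonempty) (b : ι → ℕ) (x : ℕ),
    r (∑ g ∈ s.piAntidiag x, ∏ i ∈ s, φ (b i) (g i)) (φ (∑ i ∈ s, b i + #s - 1) x)
  expand : ∀ {s : Finset ι} (_ : s.Nonempty) (f : ι → ℕ) (p : ℕ),
    r (φ p (∑ i ∈ s, f i)) (∑ c ∈ s.piAntidiag p, ∏ i ∈ s, φ (c i) (f i))

/-- Integration is an exact Vandermonde identity for this weight; only the expansion loses
something, namely `#s - 1` in the upper index. -/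
theorem isDividedPowerWeight_choose_add {ι : Type*} [DecidableEq ι] :
    IsDividedPowerWeight ι (· ≤ ·) fun b x => (b + x).choose b where
  zero_left x := by simp
  integrate hs b x := (sum_piAntidiag_prod_choose_add hs b x).le
  expand {s} hs f p := by
    have h := sum_piAntidiag_prod_choose_add hs f p
    have hsym : ∀ c : ι → ℕ, ∏ i ∈ s, (c i + f i).choose (c i)
        = ∏ i ∈ s, (f i + c i).choose (f i) := fun c =>
      prod_congr rfl fun i _ => by rw [Nat.choose_symm_add, add_comm]
    simp only [hsym, h]
    have := hs.card_pos
    rw [Nat.choose_symm_add]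
    nth_rw 1 [add_comm p]
    rw [Nat.choose_symm_add, Nat.choose_symm_add]
    exact Nat.choose_le_choose _ (by omega)

/-- Here the expansion is exact Vandermonde and the integration is the lossy step. -/
theorem isDividedPowerWeight_choose {ι : Type*} [DecidableEq ι] :
    IsDividedPowerWeight ι (· ≥ ·) fun b x => x.choose b where
  zero_left x := by simp
  integrate {s} hs b x := by
    classical
    show _ ≤ _
    have hpos := hs.card_pos
    rcases lt_or_ge x (∑ i ∈ s, b i) with hx | hx
    · rw [Nat.choose_eq_zero_of_lt (by omega)]
      exact Nat.zero_le _
    obtain ⟨y, rfl⟩ := Nat.exists_eq_add_of_le hx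
    -- Only the terms `g = b + c` with `c` of sum `y` are kept. Extending `b` by zero off `s` keeps
    -- the shifted tuples supported in `s`.
    set b' : ι → ℕ := fun i => if i ∈ s then b i else 0 with hb'
    have hbs : ∀ i ∈ s, b' i = b i := fun i hi => by simp [hb', hi]
    have h := sum_piAntidiag_prod_choose_add hs b y
    calc _ ≤ (∑ i ∈ s, b i + #s - 1 + y).choose (∑ i ∈ s, b i + #s - 1) :=
          Nat.choose_le_choose _ (by omega)
      _ = ∑ g ∈ (s.piAntidiag y).image (fun c => b' + c), ∏ i ∈ s, (g i).choose (b i) := by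
          rw [sum_image (fun c _ c' _ hcc => add_left_cancel hcc), ← h]
          refine sum_congr rfl fun c _ => prod_congr rfl fun i hi => ?_
          rw [Pi.add_apply, hbs i hi]
      _ ≤ _ := by
          refine sum_le_sum_of_subset fun g hg => ?_
          obtain ⟨c, hc, rfl⟩ := mem_image.1 hg
          rw [mem_piAntidiag] at hc ⊢
          refine ⟨?_, fun i hi => ?_⟩
          · simp only [Pi.add_apply, sum_add_distrib]
            rw [sum_congr rfl hbs, hc.1]
          · by_contra his
            exact hi (by
              have : c i = 0 := by_contra fun h0 => his (hc.2 i h0)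
              simp [hb', his, this])
  expand hs f p := (sum_piAntidiag_prod_choose _ f p).le

/-! ### Functions built fibre by fibre -/

/-- The functions `b : E → ℕ` that vanish where `k ≤ s` and whose sum over the fibre of `s` at
each `j < k` is the number `p j b`, which is meant to depend only on the values of `b` at the
fibres before `j`. -/
def fiberLevel {E : Type*} [Fintype E] [DecidableEq E] (s : E → ℕ) (p : ℕ → (E → ℕ) → ℕ) :
    ℕ → Finset (E → ℕ)
  | 0 => {0}
  | k + 1 => (fiberLevel s p k).biUnion fun b =>
      (({e | s e = k} : Finset E).piAntidiag (p k b)).image fun c => b + c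

section FiberLevel

variable {E : Type*} [Fintype E] [DecidableEq E] {s : E → ℕ} {p : ℕ → (E → ℕ) → ℕ}

/-- By `hp`, values added on fibre `k` cannot disturb the demands at fibres up to `k`, so the
recursive construction amounts to a system of conditions on the final function. -/
theorem mem_fiberLevel (hp : ∀ j b c, (∀ e, s e < j → b e = c e) → p j b = p j c) {k : ℕ} :
    ∀ {b : E → ℕ}, b ∈ fiberLevel s p k ↔
      (∀ e, k ≤ s e → b e = 0) ∧ ∀ j < k, ∑ e with s e = j, b e = p j b := by
  induction k with
  | zero =>
    intro b
    simp [fiberLevel, funext_iff]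
  | succ k ih =>
    intro b
    simp only [fiberLevel, mem_biUnion, mem_image, mem_piAntidiag, mem_filter, mem_univ, true_and]
    constructor
    · rintro ⟨b, hb, c, ⟨hc, hcs⟩, rfl⟩
      rw [ih] at hb
      have hc0 : ∀ e, s e ≠ k → c e = 0 := fun e he => by_contra fun h => he (hcs e h)
      refine ⟨fun e he => ?_, fun j hj => ?_⟩
      · simp [hb.1 e (by omega), hc0 e (by omega)]
      · have hpj : p j (b + c) = p j b := hp _ _ _ fun e he => by simp [hc0 e (by omega)]
        rw [hpj]
        simp only [Pi.add_apply, sum_add_distrib]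
        rcases Nat.lt_succ_iff_lt_or_eq.1 hj with hj | rfl
        · rw [hb.2 j hj, sum_eq_zero (f := c), add_zero]
          intro e he
          exact hc0 e (by simp at he; omega)
        · rw [hc, sum_eq_zero (f := b), zero_add]
          intro e he
          exact hb.1 e (by simp at he; omega)
    · rintro ⟨h0, hs⟩
      set b' : E → ℕ := fun e => if s e < k then b e else 0 with hb'
      have hpb : ∀ j ≤ k, p j b' = p j b := fun j hj => hp _ _ _ fun e he => by
        simp [hb', show s e < k by omega]
      refine ⟨b', ih.2 ⟨fun e he => ?_, fun j hj => ?_⟩, fun e => if s e = k then b e else 0,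
        ⟨?_, ?_⟩, ?_⟩
      · simp [hb', show ¬ s e < k by omega]
      · rw [hpb j hj.le, ← hs j (by omega)]
        refine sum_congr rfl fun e he => ?_
        have : s e = j := by simpa using he
        simp [hb', show s e < k by omega]
      · rw [hpb k le_rfl, ← hs k (by omega)]
        refine sum_congr rfl fun e he => ?_
        have : s e = k := by simpa using he
        simp [this]
      · intro e he
        by_contra h
        simp [h] at he
      · ext e
        simp only [hb', Pi.add_apply]
        rcases lt_trichotomy (s e) k with h | h | h
        · simp [h, h.ne]
        · simp [h]
        · simp [h0 e h, h.ne', h.not_gt]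

/-- The parts before fibre `k` and on it can be read off from the sum `b + c`, so no function is
produced twice. -/
theorem sum_fiberLevel_succ (hp : ∀ j b c, (∀ e, s e < j → b e = c e) → p j b = p j c) (k : ℕ)
    (F : (E → ℕ) → ℕ) :
    ∑ b ∈ fiberLevel s p (k + 1), F b
      = ∑ b ∈ fiberLevel s p k, ∑ c ∈ ({e | s e = k} : Finset E).piAntidiag (p k b), F (b + c) := by
  rw [fiberLevel, sum_biUnion]
  · exact sum_congr rfl fun b _ => sum_image fun c _ c' _ h => add_left_cancel h
  · intro b hb b' hb' hne
    rw [Function.onFun, disjoint_left]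
    intro x hx hx'
    simp only [mem_image, mem_piAntidiag, mem_filter, mem_univ, true_and] at hx hx'
    obtain ⟨c, ⟨-, hc⟩, rfl⟩ := hx
    obtain ⟨c', ⟨-, hc'⟩, h⟩ := hx'
    refine hne (funext fun e => ?_)
    rcases lt_or_ge (s e) k with he | he
    · have h0 : c e = 0 := by_contra fun h0 => he.ne (hc e h0)
      have h0' : c' e = 0 := by_contra fun h0 => he.ne (hc' e h0)
      have := congrFun h e
      simp only [Pi.add_apply, h0, h0', add_zero] at this
      exact this.symm
    · rw [((mem_fiberLevel hp).1 hb).1 e he, ((mem_fiberLevel hp).1 hb').1 e he]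

end FiberLevel

/-- A relation that is compatible with addition passes to finite sums. -/
theorem Finset.sum_rel {ι : Type*} {r : ℕ → ℕ → Prop} (hrefl : ∀ a, r a a)
    (hadd : ∀ a b c d, r a b → r c d → r (a + c) (b + d)) {s : Finset ι} {f g : ι → ℕ}
    (h : ∀ i ∈ s, r (f i) (g i)) : r (∑ i ∈ s, f i) (∑ i ∈ s, g i) := by
  classical
  induction s using Finset.induction_on with
  | empty => exact hrefl _
  | insert a s ha ih =>
    rw [sum_insert ha, sum_insert ha]
    exact hadd _ _ _ _ (h a (mem_insert_self _ _)) (ih fun i hi => h i (mem_insert_of_mem hi))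

/-! ### Netflow conditions and the two level sets -/

namespace LooplessGraph

variable {n : ℕ} {E : Type*} (H : LooplessGraph n E)

theorem init_lt_fin_val (e : E) : (H.init e : ℕ) < H.fin e := H.init_lt_fin e

theorem fin_val_le (e : E) : (H.fin e : ℕ) ≤ n := Nat.lt_succ_iff.1 (H.fin e).2

theorem sum_root (e : E) : ∑ v, H.root e v = 0 := by
  simp [root]

variable [Fintype E]

/-- The edges whose bigger endpoint has index `j`. -/
def inEdges (j : ℕ) : Finset E := {e | (H.fin e : ℕ) = j}

/-- The edges whose smaller endpoint has index `j`. -/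
def outEdges (j : ℕ) : Finset E := {e | (H.init e : ℕ) = j}

@[simp] theorem mem_inEdges {j : ℕ} {e : E} : e ∈ H.inEdges j ↔ (H.fin e : ℕ) = j := by
  simp [inEdges]

@[simp] theorem mem_outEdges {j : ℕ} {e : E} : e ∈ H.outEdges j ↔ (H.init e : ℕ) = j := by
  simp [outEdges]

theorem inEdges_zero : H.inEdges 0 = ∅ := by
  ext e
  have := H.init_lt_fin_val e
  simp only [mem_inEdges, notMem_empty, iff_false]
  omega

theorem indeg_eq_card_inEdges (v : Fin (n + 1)) : H.indeg v = #(H.inEdges v) := by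
  simp only [indeg, inEdges, Fin.val_inj]

theorem outdeg_eq_card_outEdges (v : Fin (n + 1)) : H.outdeg v = #(H.outEdges v) := by
  simp only [outdeg, outEdges, Fin.val_inj]

/-- The netflow of a function on the edges at a vertex. -/
theorem sum_mul_root {R : Type*} [Ring R] (b : E → R) (v : Fin (n + 1)) :
    ∑ e, b e * (H.root e v : R) = ∑ e ∈ H.outEdges v, b e - ∑ e ∈ H.inEdges v, b e := by
  simp only [outEdges, inEdges, sum_filter, ← sum_sub_distrib]
  refine sum_congr rfl fun e _ => ?_
  simp only [root, Pi.sub_apply, Pi.single_apply, Fin.val_inj, eq_comm (a := v)]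
  split_ifs <;> simp

theorem sum_smul_root_apply (b : E → ℕ) (v : Fin (n + 1)) :
    (∑ e, b e • H.root e) v
      = (∑ e ∈ H.outEdges v, b e : ℕ) - ((∑ e ∈ H.inEdges v, b e : ℕ) : ℤ) := by
  have h := H.sum_mul_root (fun e => (b e : ℤ)) v
  rw [Finset.sum_apply, Nat.cast_sum, Nat.cast_sum, ← h]
  simp

/-- Two vectors with the same coordinate sum are equal if they agree off one vertex. -/
theorem eq_of_sum_eq {ι R : Type*} [Fintype ι] [AddCommGroup R] {x y : ι → R} (i : ι)
    (hsum : ∑ v, x v = ∑ v, y v) (h : ∀ v, v ≠ i → x v = y v) : x = y := by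
  classical
  rw [← add_sum_erase _ _ (mem_univ i), ← add_sum_erase _ y (mem_univ i),
    sum_congr rfl fun v hv => h v (ne_of_mem_erase hv)] at hsum
  ext v
  by_cases hv : v = i
  · rw [hv]
    exact add_right_cancel hsum
  · exact h v hv

theorem sum_sum_smul_root (b : E → ℕ) : ∑ v, (∑ e, b e • H.root e) v = 0 := by
  simp only [Finset.sum_apply, Pi.smul_apply]
  rw [sum_comm]
  exact sum_eq_zero fun e _ => by rw [← smul_sum, sum_root, smul_zero]

/-- A family is counted by the Kostant partition function as soon as the condition holds at all
vertices but one. -/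
theorem mem_kostantSet_iff {a : Fin (n + 1) → ℤ} (ha : ∑ v, a v = 0) (i : Fin (n + 1))
    {b : E → ℕ} : b ∈ H.kostantSet a ↔ ∀ v, v ≠ i →
      ((∑ e ∈ H.outEdges v, b e : ℕ) : ℤ) = (∑ e ∈ H.inEdges v, b e : ℕ) + a v := by
  change ∑ e, b e • H.root e = a ↔ _
  constructor
  · intro h v _
    have := congrFun h v
    rw [sum_smul_root_apply] at this
    linarith
  · intro h
    refine eq_of_sum_eq i (by rw [ha, sum_sum_smul_root]) fun v hv => ?_
    rw [sum_smul_root_apply, h v hv]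
    ring

theorem sum_unitNetflow : ∑ v, unitNetflow n v = 0 := by
  simp [unitNetflow]

theorem sum_indegVector (hn : 1 ≤ n) : ∑ v, H.indegVector v = 0 := by
  obtain ⟨m, rfl⟩ : ∃ m, n = m + 1 := ⟨n - 1, by omega⟩
  have h : ∑ i ∈ Ioo 0 (Fin.last (m + 1)), H.shiftedIndeg i
      = ∑ i : Fin m, H.shiftedIndeg i.castSucc.succ := by
    have : Ioo 0 (Fin.last (m + 1)) = univ.image fun i : Fin m => i.castSucc.succ := by
      ext i
      simp only [mem_Ioo, mem_image, mem_univ, true_and, Fin.lt_def, Fin.val_last, Fin.ext_iff,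
        Fin.val_succ, Fin.val_castSucc, Fin.val_zero]
      exact ⟨fun hi => ⟨⟨i - 1, by omega⟩, by simp; omega⟩, fun ⟨a, ha⟩ => by omega⟩
    rw [this, sum_image fun i _ j _ hij => Fin.castSucc_injective _ (Fin.succ_injective _ hij)]
  rw [Fin.sum_univ_succ, Fin.sum_univ_castSucc]
  have h1 : H.indegVector 0 = 0 := by simp [indegVector]
  have h2 : H.indegVector (Fin.last m).succ = -∑ i ∈ Ioo 0 (Fin.last (m + 1)), H.shiftedIndeg i := by
    simp [indegVector]
  have h3 : ∀ i : Fin m, H.indegVector i.castSucc.succ = H.shiftedIndeg i.castSucc.succ := by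
    intro i
    rw [indegVector, if_neg (Fin.succ_ne_zero _), if_neg]
    rw [Fin.ext_iff]
    simp
    omega
  rw [h1, h2, h, sum_congr rfl fun i _ => h3 i]
  ring

/-- The required sum of a flow of size `t` over the edges into the vertex of index `n - j`. -/
def flowDemand (t j : ℕ) (f : E → ℕ) : ℕ := if j = 0 then t else ∑ e ∈ H.outEdges (n - j), f e

/-- The required sum over the edges out of the vertex of index `j` of a function that the Kostant
partition function counts. -/
def indegDemand (j : ℕ) (b : E → ℕ) : ℕ :=
  if j = 0 then 0 else ∑ e ∈ H.inEdges j, b e + #(H.inEdges j) - 1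

theorem flowDemand_congr (t j : ℕ) (f g : E → ℕ) (h : ∀ e, n - H.fin e < j → f e = g e) :
    H.flowDemand t j f = H.flowDemand t j g := by
  unfold flowDemand
  split_ifs with hj
  · rfl
  · refine sum_congr rfl fun e he => h e ?_
    have := H.init_lt_fin_val e
    have := H.fin_val_le e
    rw [mem_outEdges] at he
    omega

theorem indegDemand_congr (j : ℕ) (b c : E → ℕ) (h : ∀ e, (H.init e : ℕ) < j → b e = c e) :
    H.indegDemand j b = H.indegDemand j c := by
  unfold indegDemand
  split_ifs with hj
  · rfl
  · rw [sum_congr rfl fun e he => h e ?_]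
    have := H.init_lt_fin_val e
    rw [mem_inEdges] at he
    omega

theorem inEdges_eq_filter {j : ℕ} (hj : j ≤ n) :
    H.inEdges j = ({e | n - (H.fin e : ℕ) = n - j} : Finset E) := by
  ext e
  have := H.fin_val_le e
  simp only [mem_inEdges, mem_filter, mem_univ, true_and]
  omega

variable [DecidableEq E]

/-- The flows of size `t` on the edges into the last `k` vertices. -/
def flowLevel (t k : ℕ) : Finset (E → ℕ) := fiberLevel (fun e => n - H.fin e) (H.flowDemand t) k

/-- The functions on the edges out of the first `k` vertices that satisfy the conditions which the
Kostant partition function imposes at those vertices. -/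
def indegLevel (k : ℕ) : Finset (E → ℕ) := fiberLevel (fun e => H.init e) H.indegDemand k

theorem mem_indegLevel {k : ℕ} {b : E → ℕ} : b ∈ H.indegLevel k ↔
    (∀ e, k ≤ (H.init e : ℕ) → b e = 0) ∧ ∀ j < k, ∑ e ∈ H.outEdges j, b e = H.indegDemand j b :=
  mem_fiberLevel H.indegDemand_congr

theorem mem_flowLevel {t k : ℕ} {f : E → ℕ} : f ∈ H.flowLevel t k ↔
    (∀ e, k ≤ n - (H.fin e : ℕ) → f e = 0) ∧
      ∀ j < k, ∑ e with n - (H.fin e : ℕ) = j, f e = H.flowDemand t j f :=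
  mem_fiberLevel (H.flowDemand_congr t)

/-! ### Moving the cut from source to sink -/

/-- The sum in which the flow conditions at the vertices after `k` and the Kostant conditions at
the vertices up to `k` are imposed, with weights on the edges across. -/
def mixedSum (φ : ℕ → ℕ → ℕ) (t k : ℕ) : ℕ :=
  ∑ f ∈ H.flowLevel t (n - k), ∑ b ∈ H.indegLevel (k + 1),
    ∏ e with (H.init e : ℕ) ≤ k ∧ k < (H.fin e : ℕ), φ (b e) (f e)

variable {r : ℕ → ℕ → Prop} {φ : ℕ → ℕ → ℕ}

/-- Only vertex `k + 1` changes sides. Its incoming flows are integrated out and the resulting power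
is expanded over its outgoing edges; the `indeg - 1` produced by the integration is the Kostant
demand there. -/
theorem mixedSum_rel_succ (hrefl : ∀ a, r a a) (htrans : ∀ a b c, r a b → r b c → r a c)
    (hadd : ∀ a b c d, r a b → r c d → r (a + c) (b + d))
    (hmul : ∀ a b c, r a b → r (a * c) (b * c)) (hφ : IsDividedPowerWeight E r φ) (t : ℕ) {k : ℕ}
    (hk : k + 1 < n) (hin : (H.inEdges (k + 1)).Nonempty) (hout : (H.outEdges (k + 1)).Nonempty) :
    r (H.mixedSum φ t k) (H.mixedSum φ t (k + 1)) := by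
  -- Flow levels are numbered from the sink, so vertex `k + 1` is flow level `m`; `m ≠ 0` makes its
  -- demand the outflow rather than `t`.
  obtain ⟨m, rfl⟩ : ∃ m, n = m + (k + 1) := ⟨n - (k + 1), by omega⟩
  have hm : m ≠ 0 := by omega
  unfold mixedSum
  rw [show m + (k + 1) - k = m + 1 by omega, show m + (k + 1) - (k + 1) = m by omega, flowLevel,
    sum_fiberLevel_succ (H.flowDemand_congr t)]
  refine Finset.sum_rel hrefl hadd fun f hf => ?_
  rw [sum_comm, indegLevel, indegLevel, sum_fiberLevel_succ H.indegDemand_congr (k + 1)]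
  refine Finset.sum_rel hrefl hadd fun b hb => ?_
  have hf0 := (H.mem_flowLevel.1 hf).1
  have hb0 := (H.mem_indegLevel.1 hb).1
  have hset : ({e | m + (k + 1) - (H.fin e : ℕ) = m} : Finset E) = H.inEdges (k + 1) := by
    rw [H.inEdges_eq_filter (by omega), show m + (k + 1) - (k + 1) = m by omega]
  have hfd : H.flowDemand t m f = ∑ e ∈ H.outEdges (k + 1), f e := by
    rw [flowDemand, if_neg hm, show m + (k + 1) - m = k + 1 by omega]
  have hbd : H.indegDemand (k + 1) b
      = ∑ e ∈ H.inEdges (k + 1), b e + #(H.inEdges (k + 1)) - 1 := by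
    rw [indegDemand, if_neg (by omega)]
  change r (∑ g ∈ Finset.piAntidiag ({e | m + (k + 1) - (H.fin e : ℕ) = m} : Finset E)
    (H.flowDemand t m f), _) (∑ c ∈ Finset.piAntidiag (H.outEdges (k + 1))
    (H.indegDemand (k + 1) b), _)
  rw [hset, hfd, hbd]
  -- The edges passing over vertex `k + 1` cross both cuts and contribute the common factor `w`.
  set M : Finset E := {e | (H.init e : ℕ) ≤ k ∧ k + 1 < (H.fin e : ℕ)} with hM
  set w : ℕ := ∏ e ∈ M, φ (b e) (f e) with hw
  have hleft : ∀ g ∈ (H.inEdges (k + 1)).piAntidiag (∑ e ∈ H.outEdges (k + 1), f e),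
      ∏ e with (H.init e : ℕ) ≤ k ∧ k < (H.fin e : ℕ), φ (b e) ((f + g) e)
        = (∏ e ∈ H.inEdges (k + 1), φ (b e) (g e)) * w := by
    intro g hg
    rw [mem_piAntidiag] at hg
    have hsplit : ({e | (H.init e : ℕ) ≤ k ∧ k < (H.fin e : ℕ)} : Finset E)
        = H.inEdges (k + 1) ∪ M := by
      ext e
      have := H.init_lt_fin_val e
      simp only [hM, mem_union, mem_inEdges, mem_filter, mem_univ, true_and]
      omega
    rw [hsplit, prod_union]
    · congr 1
      · refine prod_congr rfl fun e he => ?_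
        rw [mem_inEdges] at he
        rw [Pi.add_apply, hf0 e (by omega), zero_add]
      · refine prod_congr rfl fun e he => ?_
        simp only [hM, mem_filter, mem_univ, true_and] at he
        have : g e = 0 := by_contra fun h => by
          have := hg.2 e h
          rw [mem_inEdges] at this
          omega
        rw [Pi.add_apply, this, add_zero]
    · rw [disjoint_left]
      intro e he he'
      simp only [hM, mem_filter, mem_univ, true_and, mem_inEdges] at he he'
      omega
  have hright : ∀ c ∈ (H.outEdges (k + 1)).piAntidiag
        (∑ e ∈ H.inEdges (k + 1), b e + #(H.inEdges (k + 1)) - 1),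
      ∏ e with (H.init e : ℕ) ≤ k + 1 ∧ k + 1 < (H.fin e : ℕ), φ ((b + c) e) (f e)
        = (∏ e ∈ H.outEdges (k + 1), φ (c e) (f e)) * w := by
    intro c hc
    rw [mem_piAntidiag] at hc
    have hsplit : ({e | (H.init e : ℕ) ≤ k + 1 ∧ k + 1 < (H.fin e : ℕ)} : Finset E)
        = H.outEdges (k + 1) ∪ M := by
      ext e
      have := H.init_lt_fin_val e
      simp only [hM, mem_union, mem_outEdges, mem_filter, mem_univ, true_and]
      omega
    rw [hsplit, prod_union]
    · congr 1
      · refine prod_congr rfl fun e he => ?_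
        rw [mem_outEdges] at he
        rw [Pi.add_apply, hb0 e (by omega), zero_add]
      · refine prod_congr rfl fun e he => ?_
        simp only [hM, mem_filter, mem_univ, true_and] at he
        have : c e = 0 := by_contra fun h => by
          have := hc.2 e h
          rw [mem_outEdges] at this
          omega
        rw [Pi.add_apply, this, add_zero]
    · rw [disjoint_left]
      intro e he he'
      simp only [hM, mem_filter, mem_univ, true_and, mem_outEdges] at he he'
      omega
  rw [sum_congr rfl hleft, sum_congr rfl hright, ← sum_mul, ← sum_mul]
  exact hmul _ _ _ (htrans _ _ _ (hφ.integrate hin b _) (hφ.expand hout f _))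

/-- The Kostant demand at the source is `0`, which forces `b = 0` and makes every weight `1`. -/
theorem mixedSum_zero (hzero : ∀ x, φ 0 x = 1) (t : ℕ) :
    H.mixedSum φ t 0 = #(H.flowLevel t n) := by
  have hlevel : H.indegLevel 1 = {0} := by
    ext b
    rw [mem_indegLevel, mem_singleton]
    constructor
    · rintro ⟨h1, h0⟩
      have h0 : ∀ e ∈ H.outEdges 0, b e = 0 := by
        rw [← sum_eq_zero_iff, h0 0 one_pos, indegDemand, if_pos rfl]
      ext e
      by_cases he : (H.init e : ℕ) = 0
      · exact h0 e (by simpa using he)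
      · exact h1 e (by omega)
    · rintro rfl
      refine ⟨fun _ _ => rfl, fun j hj => ?_⟩
      simp [indegDemand, show j = 0 by omega]
  simp [mixedSum, hlevel, hzero]

/-- Adding the Kostant conditions at all vertices but the sink, everything telescopes except the
inflow at the sink. Hence the last exponent does not depend on `b`; it is the dimension of the
polytope. -/
theorem sum_inEdges_last {b : E → ℕ} (hn : 1 ≤ n) (hin : ∀ j, 1 ≤ j → j ≤ n → (H.inEdges j).Nonempty)
    (hb : b ∈ H.indegLevel n) :
    ∑ e ∈ H.inEdges n, b e + #(H.inEdges n) - 1 = Fintype.card E - n := by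
  obtain ⟨m, rfl⟩ : ∃ m, n = m + 1 := ⟨n - 1, by omega⟩
  have hinit : ∑ e, b e = ∑ j ∈ range (m + 1), ∑ e ∈ H.outEdges j, b e :=
    (sum_fiberwise_of_maps_to (fun e _ => mem_range.2
      ((H.init_lt_fin_val e).trans_le (H.fin_val_le e))) _).symm
  have hmaps : ∀ e ∈ (univ : Finset E), (H.fin e : ℕ) ∈ range (m + 2) :=
    fun e _ => mem_range.2 (H.fin e).2
  have hfin : ∑ e, b e = ∑ j ∈ range (m + 2), ∑ e ∈ H.inEdges j, b e :=
    (sum_fiberwise_of_maps_to hmaps _).symm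
  have hcard : Fintype.card E = ∑ j ∈ range (m + 2), #(H.inEdges j) :=
    card_eq_sum_card_fiberwise hmaps
  rw [sum_range_succ, sum_range_succ', inEdges_zero] at hfin hcard
  rw [sum_range_succ', ((H.mem_indegLevel.1 hb).2 0 (by omega)), indegDemand, if_pos rfl] at hinit
  have hstep : ∑ j ∈ range m, ∑ e ∈ H.outEdges (j + 1), b e + m
      = ∑ j ∈ range m, ∑ e ∈ H.inEdges (j + 1), b e + ∑ j ∈ range m, #(H.inEdges (j + 1)) := by
    rw [← sum_add_distrib]
    -- Writing `m` as a sum of ones cancels the truncated `- 1` of each demand vertex by vertex.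
    have hm : m = ∑ j ∈ range m, 1 := by simp
    refine (congrArg (_ + ·) hm).trans ?_
    rw [← sum_add_distrib]
    refine sum_congr rfl fun j hj => ?_
    rw [mem_range] at hj
    rw [(H.mem_indegLevel.1 hb).2 (j + 1) (by omega), indegDemand, if_neg (by omega)]
    have := (hin (j + 1) (by omega) (by omega)).card_pos
    omega
  have := (hin (m + 1) (by omega) le_rfl).card_pos
  simp only [sum_empty, card_empty] at hfin hcard
  omega

/-- The edges across the last cut are those into the sink, subject only to having total flow `t`, so
one more integration finishes. -/
theorem mixedSum_last_rel (hrefl : ∀ a, r a a)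
    (hadd : ∀ a b c d, r a b → r c d → r (a + c) (b + d)) (hφ : IsDividedPowerWeight E r φ)
    (hn : 1 ≤ n) (hin : ∀ j, 1 ≤ j → j ≤ n → (H.inEdges j).Nonempty) (t : ℕ) :
    r (H.mixedSum φ t (n - 1)) (#(H.indegLevel n) * φ (Fintype.card E - n) t) := by
  unfold mixedSum
  rw [show n - (n - 1) = 0 + 1 by omega, show n - 1 + 1 = n by omega, flowLevel,
    sum_fiberLevel_succ (H.flowDemand_congr t), fiberLevel, sum_singleton, sum_comm, card_eq_sum_ones,
    sum_mul]
  refine Finset.sum_rel hrefl hadd fun b hb => ?_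
  have h := hφ.integrate (hin n hn le_rfl) b t
  rw [H.sum_inEdges_last hn hin hb] at h
  have hset : ({e | n - (H.fin e : ℕ) = 0} : Finset E) = H.inEdges n := by
    rw [H.inEdges_eq_filter le_rfl, Nat.sub_self]
  have hset' : ({e | (H.init e : ℕ) ≤ n - 1 ∧ n - 1 < (H.fin e : ℕ)} : Finset E)
      = H.inEdges n := by
    ext e
    have := H.init_lt_fin_val e
    have := H.fin_val_le e
    simp only [mem_inEdges, mem_filter, mem_univ, true_and]
    omega
  rw [hset, hset', one_mul]
  simpa [flowDemand] using h

/-- Keeping the relation `r` abstract lets one argument yield both the upper and the lower bound. -/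
theorem card_flowLevel_rel (hrefl : ∀ a, r a a) (htrans : ∀ a b c, r a b → r b c → r a c)
    (hadd : ∀ a b c d, r a b → r c d → r (a + c) (b + d))
    (hmul : ∀ a b c, r a b → r (a * c) (b * c)) (hφ : IsDividedPowerWeight E r φ) (hn : 1 ≤ n)
    (hin : ∀ j, 1 ≤ j → j ≤ n → (H.inEdges j).Nonempty)
    (hout : ∀ j, j < n → (H.outEdges j).Nonempty) (t : ℕ) :
    r #(H.flowLevel t n) (#(H.indegLevel n) * φ (Fintype.card E - n) t) := by
  have hstep : ∀ k < n, r (H.mixedSum φ t 0) (H.mixedSum φ t k) := by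
    intro k
    induction k with
    | zero => exact fun _ => hrefl _
    | succ k ih =>
      exact fun hk => htrans _ _ _ (ih (by omega)) (H.mixedSum_rel_succ hrefl htrans hadd hmul hφ t
        hk (hin _ (by omega) (by omega)) (hout _ hk))
  rw [← H.mixedSum_zero hφ.zero_left]
  exact htrans _ _ _ (hstep (n - 1) (by omega)) (H.mixedSum_last_rel hrefl hadd hφ hn hin t)

theorem card_flowLevel_le (hn : 1 ≤ n) (hin : ∀ j, 1 ≤ j → j ≤ n → (H.inEdges j).Nonempty)
    (hout : ∀ j, j < n → (H.outEdges j).Nonempty) (t : ℕ) :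
    #(H.flowLevel t n) ≤ #(H.indegLevel n)
      * (Fintype.card E - n + t).choose (Fintype.card E - n) :=
  H.card_flowLevel_rel le_refl (fun _ _ _ => le_trans) (fun _ _ _ _ => add_le_add)
    (fun _ _ c h => Nat.mul_le_mul_right c h) isDividedPowerWeight_choose_add hn hin hout t

theorem le_card_flowLevel (hn : 1 ≤ n) (hin : ∀ j, 1 ≤ j → j ≤ n → (H.inEdges j).Nonempty)
    (hout : ∀ j, j < n → (H.outEdges j).Nonempty) (t : ℕ) :
    #(H.indegLevel n) * t.choose (Fintype.card E - n) ≤ #(H.flowLevel t n) :=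
  H.card_flowLevel_rel (r := (· ≥ ·)) le_refl (fun _ _ _ h h' => le_trans h' h)
    (fun _ _ _ _ h h' => add_le_add h h') (fun _ _ c h => Nat.mul_le_mul_right c h)
    isDividedPowerWeight_choose hn hin hout t

/-- The omitted condition at the sink follows from the others, as all coordinates sum to zero.
Nonempty in-edge sets make the truncated `- 1` in `indegDemand` a true subtraction. -/
theorem coe_indegLevel (hn : 1 ≤ n) (hin : ∀ j, 1 ≤ j → j ≤ n → (H.inEdges j).Nonempty) :
    (H.indegLevel n : Set (E → ℕ)) = H.kostantSet H.indegVector := by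
  ext b
  rw [mem_coe, mem_indegLevel, H.mem_kostantSet_iff (H.sum_indegVector hn) (Fin.last n)]
  have hvec : ∀ v : Fin (n + 1), v ≠ Fin.last n →
      (((∑ e ∈ H.outEdges v, b e : ℕ) : ℤ) = (∑ e ∈ H.inEdges v, b e : ℕ) + H.indegVector v
        ↔ ∑ e ∈ H.outEdges v, b e = H.indegDemand v b) := by
    intro v hv
    by_cases h0 : v = 0
    · subst h0
      rw [Fin.val_zero, inEdges_zero, sum_empty, Nat.cast_zero, zero_add, indegVector, if_pos rfl,
        indegDemand, if_pos rfl]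
      norm_cast
    · have hv1 : 1 ≤ (v : ℕ) := Nat.one_le_iff_ne_zero.2 fun h => h0 (Fin.ext h)
      have := (hin v hv1 v.is_le).card_pos
      rw [indegVector, if_neg h0, if_neg hv, shiftedIndeg, indeg_eq_card_inEdges, indegDemand,
        if_neg (by omega)]
      omega
  constructor
  · rintro ⟨-, h⟩ v hv
    exact (hvec v hv).2 (h v (Fin.val_lt_last hv))
  · intro h
    refine ⟨fun e he => absurd he (not_le.2 ((H.init_lt_fin_val e).trans_le (H.fin_val_le e))),
      fun j hj => ?_⟩
    have hv : (⟨j, hj.trans n.lt_succ_self⟩ : Fin (n + 1)) ≠ Fin.last n := Fin.ne_of_val_ne hj.ne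
    exact (hvec _ hv).1 (h _ hv)

/-- Here the redundant condition is the one at the source. -/
theorem coe_flowLevel (t : ℕ) :
    (H.flowLevel t n : Set (E → ℕ)) = H.kostantSet (t • unitNetflow n) := by
  have hsum : ∑ v, (t • unitNetflow n) v = 0 := by
    simp only [Pi.smul_apply, ← smul_sum, sum_unitNetflow, smul_zero]
  ext f
  rw [mem_coe, mem_flowLevel, H.mem_kostantSet_iff hsum 0]
  have hvec : ∀ v : Fin (n + 1), v ≠ 0 →
      (((∑ e ∈ H.outEdges v, f e : ℕ) : ℤ) = (∑ e ∈ H.inEdges v, f e : ℕ) + (t • unitNetflow n) v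
        ↔ ∑ e ∈ H.inEdges v, f e = H.flowDemand t (n - v) f) := by
    intro v hv
    by_cases hl : v = Fin.last n
    · subst hl
      have hout : H.outEdges n = ∅ := by
        ext e
        have := H.init_lt_fin_val e
        have := H.fin_val_le e
        simp only [mem_outEdges, notMem_empty, iff_false]
        omega
      simp only [Fin.val_last, hout, sum_empty, Pi.smul_apply, unitNetflow, Pi.sub_apply,
        Pi.single_eq_same, Pi.single_eq_of_ne hv, flowDemand, Nat.sub_self, if_true,
        nsmul_eq_mul, zero_sub, mul_neg, mul_one]
      omega
    · have : (v : ℕ) < n := Fin.val_lt_last hl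
      rw [flowDemand, if_neg (by omega), show n - (n - (v : ℕ)) = v by omega]
      simp [unitNetflow, hv, hl]
      norm_cast
      exact eq_comm
  constructor
  · rintro ⟨-, h⟩ v hv
    refine (hvec v hv).2 ?_
    have hv0 : (v : ℕ) ≠ 0 := fun h => hv (Fin.ext h)
    rw [H.inEdges_eq_filter v.is_le]
    exact h _ (by omega)
  · intro h
    refine ⟨fun e he => ?_, fun j hj => ?_⟩
    · have := H.init_lt_fin_val e
      have := H.fin_val_le e
      omega
    have hv : (⟨n - j, by omega⟩ : Fin (n + 1)) ≠ 0 := Fin.ne_of_val_ne (by simp; omega)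
    have := (hvec _ hv).1 (h _ hv)
    rw [H.inEdges_eq_filter (by simp)] at this
    simpa only [show n - (n - j) = j by omega] using this

end LooplessGraph

/-! ### Normalized volume as a limit of lattice-point counts -/

section Lattice

open MeasureTheory Module Filter Topology Bornology Pointwise

/-- Counting points of finer and finer dilates of a lattice in a bounded convex set gives the
quotient of the volume of the set by the covolume, for every Haar measure. -/
theorem ZLattice.tendsto_card_div_pow_of_convex {F : Type*} [NormedAddCommGroup F]
    [NormedSpace ℝ F] [FiniteDimensional ℝ F] [MeasurableSpace F] [BorelSpace F] (μ : Measure F)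
    [μ.IsAddHaarMeasure] (L : Submodule ℤ F) [DiscreteTopology L] [IsZLattice ℝ L] {s : Set F}
    (hb : IsBounded s) (hm : MeasurableSet s) (hc : Convex ℝ s) :
    Tendsto (fun t : ℕ => (Nat.card (s ∩ (t : ℝ)⁻¹ • (L : Set F) : Set F) : ℝ) / t ^ finrank ℝ F)
      atTop (𝓝 (μ.real s / ZLattice.covolume L μ)) := by
  have := ZLattice.module_free ℝ L
  have := ZLattice.module_finite ℝ L
  set b := Free.chooseBasis ℤ L
  set B := b.ofZLatticeBasis ℝ L
  set e := B.equivFunL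
  -- In coordinates of a lattice basis the limit is the Lebesgue volume of the image; convexity
  -- makes the frontier null.
  have hcount := ZLattice.covolume.tendsto_card_div_pow'' b hb hm
    (Convex.addHaar_frontier _ (hc.linear_image B.equivFun.toLinearMap))
  have hmap : ∀ T : Set F, μ T = (μ.map e) (B.equivFun '' T) := by
    intro T
    have : (μ.map e) = μ.map e.toHomeomorph.toMeasurableEquiv := rfl
    rw [this, MeasurableEquiv.map_apply]
    congr 1
    exact (Set.preimage_image_eq T B.equivFun.injective).symm
  have hhaar : (μ.map e).IsAddHaarMeasure := e.isAddHaarMeasure_map μ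
  have hsmul := Measure.isAddLeftInvariant_eq_smul (μ.map e) volume
  have hpos := Measure.addHaarScalarFactor_pos_of_isAddHaarMeasure (μ.map e) volume
  set c := Measure.addHaarScalarFactor (μ.map e) volume
  have hreal : ∀ T : Set F, μ.real T = c * volume.real (B.equivFun '' T) := by
    intro T
    rw [Measure.real, hmap, hsmul, Measure.smul_apply, ENNReal.smul_def, smul_eq_mul,
      ENNReal.toReal_mul, ENNReal.coe_toReal, Measure.real]
  -- A fundamental domain maps to the unit cube, so the covolume is exactly the factor between the
  -- pushforward of `μ` and Lebesgue measure.
  have hcov : ZLattice.covolume L μ = c := by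
    rw [ZLattice.covolume_eq_measure_fundamentalDomain L μ (ZLattice.isAddFundamentalDomain b μ),
      hreal]
    have : B.equivFun '' ZSpan.fundamentalDomain B
        = ZSpan.fundamentalDomain (Pi.basisFun ℝ (Free.ChooseBasisIndex ℤ L)) := by
      rw [ZSpan.map_fundamentalDomain]
      congr 1
      ext i j
      simp [Pi.single_apply, eq_comm]
    rw [this, ZSpan.fundamentalDomain_pi_basisFun, Measure.real, volume_pi_pi]
    simp
  rw [← finrank_eq_card_basis B] at hcount
  have hc0 : (c : ℝ) ≠ 0 := NNReal.coe_ne_zero.2 hpos.ne'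
  rwa [hcov, hreal, mul_div_cancel_left₀ _ hc0]

instance integerLattice.discreteTopology {E : Type*} [Fintype E] (V : Submodule ℝ (E → ℝ)) :
    DiscreteTopology (integerLattice V) := by
  refine DiscreteTopology.of_forall_le_dist one_pos ?_
  intro x y hxy
  obtain ⟨e, he⟩ : ∃ e, ((x : V) : E → ℝ) e ≠ ((y : V) : E → ℝ) e := by
    by_contra! h
    exact hxy (Subtype.ext (Subtype.ext (funext h)))
  obtain ⟨k, hk⟩ := x.2 e
  obtain ⟨l, hl⟩ := y.2 e
  refine le_trans ?_ (dist_le_pi_dist ((x : V) : E → ℝ) ((y : V) : E → ℝ) e)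
  rw [hk, hl] at he ⊢
  rw [Real.dist_eq, ← Int.cast_sub, ← Int.cast_abs]
  have hkl : k - l ≠ 0 := sub_ne_zero.2 fun h => he (by rw [h])
  exact_mod_cast Int.one_le_abs hkl

/-- Translation invariance replaces the arbitrary base point of the definition by any `p` in `P`, so
that an integral `p` can be used when counting. -/
theorem normalizedVolume_eq_of_tendsto {E : Type*} [Fintype E] {P : Set (E → ℝ)}
    {V : Submodule ℝ (E → ℝ)} (hV : vectorSpan ℝ P = V) [IsZLattice ℝ (integerLattice V)]
    {p : E → ℝ} (hp : p ∈ P) (hb : IsBounded P) (hm : IsClosed P) (hc : Convex ℝ P) {l : ℝ}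
    (hl : Tendsto (fun t : ℕ => (Nat.card ({v : V | p + v ∈ P} ∩
      (t : ℝ)⁻¹ • (integerLattice V : Set V) : Set V) : ℝ) / t ^ finrank ℝ V) atTop (𝓝 l)) :
    normalizedVolume P = (finrank ℝ V).factorial * l := by
  have hne : P.Nonempty := ⟨p, hp⟩
  subst hV
  have hw : hne.some - p ∈ vectorSpan ℝ P := vsub_mem_vectorSpan ℝ hne.some_mem hp
  have hS : {v : vectorSpan ℝ P | hne.some + (v : E → ℝ) ∈ P}
      = (fun v => v + ⟨hne.some - p, hw⟩) ⁻¹' {v : vectorSpan ℝ P | p + (v : E → ℝ) ∈ P} := by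
    ext v
    have : p + ((v : E → ℝ) + (hne.some - p)) = hne.some + v := by abel
    simp [this]
  have hcont : Continuous fun v : vectorSpan ℝ P => p + (v : E → ℝ) := by fun_prop
  have hbS : IsBounded {v : vectorSpan ℝ P | p + (v : E → ℝ) ∈ P} := by
    rw [← isBounded_image_subtype_val]
    refine (hb.vadd (-p)).subset ?_
    rintro _ ⟨v, hv, rfl⟩
    exact ⟨_, hv, by simp⟩
  have hcS : Convex ℝ {v : vectorSpan ℝ P | p + (v : E → ℝ) ∈ P} :=
    (hc.translate_preimage_right p).linear_preimage (vectorSpan ℝ P).subtype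
  have := ZLattice.tendsto_card_div_pow_of_convex Measure.addHaar
    (integerLattice (vectorSpan ℝ P)) hbS (hm.preimage hcont).measurableSet hcS
  rw [normalizedVolume, dif_pos hne, tendsto_nhds_unique hl this]
  simp only [hS, Measure.real, measure_preimage_add_right]

end Lattice

/-- The binomial coefficients `(c + t).choose d` grow like `t ^ d / d!`. -/
theorem tendsto_choose_add_div_pow (c d : ℕ) :
    Filter.Tendsto (fun t : ℕ => ((c + t).choose d : ℝ) / t ^ d) Filter.atTop
      (nhds (d.factorial : ℝ)⁻¹) := by
  have hshift : Filter.Tendsto (fun t : ℕ => c + t) Filter.atTop Filter.atTop :=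
    Filter.tendsto_atTop_mono (fun t => Nat.le_add_left t c) Filter.tendsto_id
  have hratio : Filter.Tendsto (fun t : ℕ => ((c : ℝ) * (t : ℝ)⁻¹ + 1) ^ d / d.factorial)
      Filter.atTop (nhds (d.factorial : ℝ)⁻¹) := by
    have := (((tendsto_inv_atTop_nhds_zero_nat (𝕜 := ℝ)).const_mul (c : ℝ)).add_const 1).pow d
    simpa using this.div_const (d.factorial : ℝ)
  have hequiv := (isEquivalent_choose d).comp_tendsto hshift
  refine ((hequiv.div (Asymptotics.IsEquivalent.refl
    (u := fun t : ℕ => (t : ℝ) ^ d))).symm.tendsto_nhds (hratio.congr' ?_))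
  filter_upwards [Filter.eventually_ne_atTop 0] with t ht
  have ht : (t : ℝ) ≠ 0 := Nat.cast_ne_zero.2 ht
  simp only [Function.comp_apply, Pi.div_apply, Nat.cast_add]
  rw [div_right_comm, ← div_pow, add_div, div_self ht, div_eq_mul_inv (c : ℝ)]

/-! ### Geometry and lattice points of the unit flow polytope -/

namespace LooplessGraph

open Module Filter Topology Pointwise

variable {n : ℕ} {E : Type*} [Fintype E] (H : LooplessGraph n E)

/-- A natural flow from any vertex to the last one. -/
theorem exists_flow_to_last (hout : ∀ j, j < n → (H.outEdges j).Nonempty) (v : Fin (n + 1)) :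
    ∃ b : E → ℕ, ∑ e, b e • H.root e = Pi.single v 1 - Pi.single (Fin.last n) 1 := by
  classical
  induction v using WellFoundedGT.induction with
  | ind v ih =>
    by_cases hv : v = Fin.last n
    · exact ⟨0, by simp [hv]⟩
    obtain ⟨e, he⟩ := hout v (Fin.val_lt_last hv)
    have he : H.init e = v := Fin.ext (H.mem_outEdges.1 he)
    obtain ⟨b, hb⟩ := ih (H.fin e) (he ▸ H.init_lt_fin e)
    refine ⟨b + Pi.single e 1, ?_⟩
    simp only [Pi.add_apply, add_smul, sum_add_distrib, hb]
    simp [Pi.single_apply, root, he]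

/-- A natural flow from the first vertex to any other. -/
theorem exists_flow_from_zero (hin : ∀ j, 1 ≤ j → j ≤ n → (H.inEdges j).Nonempty)
    (v : Fin (n + 1)) :
    ∃ b : E → ℕ, ∑ e, b e • H.root e = Pi.single 0 1 - Pi.single v 1 := by
  classical
  induction v using WellFoundedLT.induction with
  | ind v ih =>
    by_cases hv : v = 0
    · exact ⟨0, by simp [hv]⟩
    obtain ⟨e, he⟩ := hin v (Nat.one_le_iff_ne_zero.2 fun h => hv (Fin.ext h)) v.is_le
    have he : H.fin e = v := Fin.ext (H.mem_inEdges.1 he)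
    obtain ⟨b, hb⟩ := ih (H.init e) (he ▸ H.init_lt_fin e)
    refine ⟨b + Pi.single e 1, ?_⟩
    simp only [Pi.add_apply, add_smul, sum_add_distrib, hb]
    simp [Pi.single_apply, root, he]

/-- Join `e` to the source and to the sink. Averaging these flows over `e` gives a strictly positive
point of the polytope. -/
theorem exists_unit_flow_pos (hin : ∀ j, 1 ≤ j → j ≤ n → (H.inEdges j).Nonempty)
    (hout : ∀ j, j < n → (H.outEdges j).Nonempty) (e : E) :
    ∃ b : E → ℕ, ∑ e, b e • H.root e = unitNetflow n ∧ 1 ≤ b e := by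
  classical
  obtain ⟨b, hb⟩ := H.exists_flow_from_zero hin (H.init e)
  obtain ⟨c, hc⟩ := H.exists_flow_to_last hout (H.fin e)
  refine ⟨b + Pi.single e 1 + c, ?_, by simp; omega⟩
  simp only [Pi.add_apply, add_smul, sum_add_distrib, hb, hc]
  simp [Pi.single_apply, root, unitNetflow]

/-- The netflow of a real function on the edges, as a linear map. -/
def netflow : (E → ℝ) →ₗ[ℝ] (Fin (n + 1) → ℝ) where
  toFun f v := ∑ e, f e * (H.root e v : ℝ)
  map_add' f g := by
    ext v
    simp [add_mul, sum_add_distrib]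
  map_smul' c f := by
    ext v
    simp [mul_sum, mul_assoc]

theorem netflow_apply (f : E → ℝ) (v : Fin (n + 1)) :
    H.netflow f v = ∑ e, f e * (H.root e v : ℝ) := rfl

theorem sum_netflow (f : E → ℝ) : ∑ v, H.netflow f v = 0 := by
  simp only [netflow_apply]
  rw [sum_comm]
  refine sum_eq_zero fun e _ => ?_
  rw [← mul_sum, ← Int.cast_sum, sum_root, Int.cast_zero, mul_zero]

theorem netflow_natCast (b : E → ℕ) :
    H.netflow (fun e => (b e : ℝ)) = fun v => (((∑ e, b e • H.root e) v : ℤ) : ℝ) := by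
  ext v
  simp [netflow_apply, Finset.sum_apply]

theorem mem_flowPolytope {a : Fin (n + 1) → ℤ} {f : E → ℝ} :
    f ∈ H.flowPolytope a ↔ (∀ e, 0 ≤ f e) ∧ H.netflow f = fun v => (a v : ℝ) := by
  rw [funext_iff]
  rfl

theorem netflow_single (e : E) [DecidableEq E] :
    H.netflow (Pi.single e 1) = fun v => (H.root e v : ℝ) := by
  ext v
  simp [netflow_apply, Pi.single_apply]

/-- The space of real functions on the edges with vanishing netflow is spanned by its integer
points. -/
theorem isZLattice_integerLattice_ker_netflow
    (hout : ∀ j, j < n → (H.outEdges j).Nonempty) :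
    IsZLattice ℝ (integerLattice (LinearMap.ker H.netflow)) := by
  classical
  choose p hp using H.exists_flow_to_last hout
  have hp' : ∀ v u, H.netflow (fun e => (p v e : ℝ)) u
      = (Pi.single v 1 - Pi.single (Fin.last n) 1 : Fin (n + 1) → ℝ) u := by
    intro v u
    rw [netflow_natCast, hp]
    simp [Pi.single_apply]
  let q : Fin (n + 1) → E → ℝ := fun v e => (p v e : ℝ)
  -- An edge is closed up to an integral circulation using the chosen flows to the sink. In `∑ e, f
  -- e • c e` the corrections group by vertex with the netflow of `f` as coefficients, hence vanish.
  let c : E → E → ℝ := fun e => Pi.single e 1 - q (H.init e) + q (H.fin e)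
  have hc : ∀ e, c e ∈ LinearMap.ker H.netflow := by
    intro e
    rw [LinearMap.mem_ker, map_add, map_sub, netflow_single]
    ext v
    simp only [Pi.add_apply, Pi.sub_apply, q, hp', root, Pi.zero_apply]
    simp [Pi.single_apply]
  have hcZ : ∀ e, (⟨c e, hc e⟩ : LinearMap.ker H.netflow)
      ∈ integerLattice (LinearMap.ker H.netflow) := fun e i =>
    ⟨(Pi.single e 1 : E → ℤ) i - p (H.init e) i + p (H.fin e) i, by
      simp [c, q, Pi.single_apply]⟩
  refine ⟨eq_top_iff.2 fun f _ => ?_⟩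
  have hf : f = ∑ e, (f : E → ℝ) e • (⟨c e, hc e⟩ : LinearMap.ker H.netflow) := by
    refine Subtype.ext ?_
    have hzero : ∑ e, (f : E → ℝ) e • (q (H.init e) - q (H.fin e)) = 0 := by
      have hker := LinearMap.mem_ker.1 f.2
      calc ∑ e, (f : E → ℝ) e • (q (H.init e) - q (H.fin e))
          = ∑ e, (f : E → ℝ) e • ∑ v, (H.root e v : ℝ) • q v := by
            refine sum_congr rfl fun e _ => ?_
            simp [root, sub_smul, sum_sub_distrib, Pi.single_apply]
        _ = ∑ v, H.netflow f v • q v := by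
            simp only [smul_sum, netflow_apply, sum_smul, mul_smul]
            exact sum_comm
        _ = 0 := by simp [hker]
    have hsplit : ∀ e, (f : E → ℝ) e • c e = (f : E → ℝ) e • (Pi.single e 1 : E → ℝ)
        - (f : E → ℝ) e • (q (H.init e) - q (H.fin e)) := by
      intro e
      simp only [c, smul_add, smul_sub]
      abel
    rw [AddSubmonoidClass.coe_finsetSum]
    simp only [Submodule.coe_smul, hsplit, sum_sub_distrib, hzero, sub_zero]
    exact pi_eq_sum_univ' _
  rw [hf]
  exact Submodule.sum_mem _ fun e _ => Submodule.smul_mem _ _ (Submodule.subset_span (hcZ e))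

/-- Netflows sum to zero, so dropping the last coordinate keeps the kernel; the flows to the sink
then hit the standard basis, and rank-nullity applies. -/
theorem finrank_ker_netflow_add (hout : ∀ j, j < n → (H.outEdges j).Nonempty) :
    n + finrank ℝ (LinearMap.ker H.netflow) = Fintype.card E := by
  classical
  set A : (E → ℝ) →ₗ[ℝ] (Fin n → ℝ) := (LinearMap.funLeft ℝ ℝ Fin.castSucc) ∘ₗ H.netflow with hA
  have hker : LinearMap.ker A = LinearMap.ker H.netflow := by
    ext f
    rw [LinearMap.mem_ker, LinearMap.mem_ker]
    constructor
    · intro h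
      refine eq_of_sum_eq (Fin.last n) (by simp [sum_netflow]) fun v hv => ?_
      have := congrFun h (v.castPred hv)
      simpa [hA, LinearMap.funLeft_apply] using this
    · intro h
      rw [hA, LinearMap.comp_apply, h, map_zero]
  have hrange : LinearMap.range A = ⊤ := by
    choose p hp using H.exists_flow_to_last hout
    refine LinearMap.range_eq_top.2 fun g => ⟨∑ i, g i • fun e => (p i.castSucc e : ℝ), ?_⟩
    rw [map_sum]
    have hAp : ∀ i : Fin n, A (fun e => (p i.castSucc e : ℝ)) = Pi.single i 1 := by
      intro i
      ext j
      rw [hA, LinearMap.comp_apply, LinearMap.funLeft_apply, netflow_natCast, hp]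
      simp [Pi.single_apply, (Fin.castSucc_lt_last j).ne]
    simp only [map_smul, hAp]
    exact (pi_eq_sum_univ' _).symm
  have := LinearMap.finrank_range_add_finrank_ker A
  rwa [hrange, hker, finrank_top, finrank_fintype_fun_eq_card, finrank_fintype_fun_eq_card,
    Fintype.card_fin] at this

theorem convex_flowPolytope (a : Fin (n + 1) → ℤ) : Convex ℝ (H.flowPolytope a) := by
  intro f hf g hg s t hs ht hst
  rw [mem_flowPolytope] at hf hg ⊢
  refine ⟨fun e => add_nonneg (mul_nonneg hs (hf.1 e)) (mul_nonneg ht (hg.1 e)), ?_⟩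
  rw [map_add, map_smul, map_smul, hf.2, hg.2, ← add_smul, hst, one_smul]

theorem isClosed_flowPolytope (a : Fin (n + 1) → ℤ) : IsClosed (H.flowPolytope a) := by
  simp only [flowPolytope, Set.ofPred_and, Set.ofPred_forall]
  exact (isClosed_iInter fun e => isClosed_le continuous_const (continuous_apply e)).inter
    (isClosed_iInter fun v => isClosed_eq (by fun_prop) continuous_const)

theorem isBounded_flowPolytope (a : Fin (n + 1) → ℤ) :
    Bornology.IsBounded (H.flowPolytope a) := by
  -- Pairing the netflow with `v ↦ -v` weights each edge by its length, which is at least `1`; so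
  -- `c` bounds every coordinate.
  set c : ℝ := ∑ v : Fin (n + 1), -(v.val : ℝ) * a v with hc
  refine (Metric.isBounded_Icc (0 : E → ℝ) fun _ => c).subset fun f hf => ⟨hf.1, fun e => ?_⟩
  have hroot : ∀ e, ∑ v : Fin (n + 1), -(v.val : ℝ) * H.root e v
      = (H.fin e).val - (H.init e).val := by
    intro e
    simp [root, mul_sub, Finset.sum_sub_distrib, Pi.single_apply]
    ring
  have hsum : c = ∑ e, f e * ((H.fin e).val - (H.init e).val : ℝ) := by
    simp only [hc, ← hf.2, mul_sum, ← hroot]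
    rw [sum_comm]
    exact sum_congr rfl fun e _ => sum_congr rfl fun v _ => by ring
  have hpos : ∀ e, (1 : ℝ) ≤ (H.fin e).val - (H.init e).val := by
    intro e
    rw [le_sub_iff_add_le']
    exact_mod_cast H.init_lt_fin_val e
  calc f e ≤ f e * ((H.fin e).val - (H.init e).val) := le_mul_of_one_le_right (hf.1 e) (hpos e)
    _ ≤ c := hsum ▸ single_le_sum
        (f := fun e => f e * ((H.fin e).val - (H.init e).val : ℝ))
        (fun i _ => mul_nonneg (hf.1 i) (by linarith [hpos i])) (mem_univ e)

/-- The unit flow polytope has full dimension in the space of its directions. -/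
theorem vectorSpan_flowPolytope [Nonempty E]
    (hin : ∀ j, 1 ≤ j → j ≤ n → (H.inEdges j).Nonempty)
    (hout : ∀ j, j < n → (H.outEdges j).Nonempty) :
    vectorSpan ℝ (H.flowPolytope (unitNetflow n)) = LinearMap.ker H.netflow := by
  refine le_antisymm (Submodule.span_le.2 ?_) fun g hg => ?_
  · rintro _ ⟨f, hf, g, hg, rfl⟩
    rw [mem_flowPolytope] at hf hg
    simp [hf.2, hg.2]
  choose b hb hbpos using H.exists_unit_flow_pos hin hout
  set m : ℝ := (Fintype.card E : ℝ) with hm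
  have hm0 : 0 < m := by simp [hm, Fintype.card_pos]
  set f : E → ℝ := m⁻¹ • ∑ i, fun e => (b i e : ℝ) with hf
  have hfm : ∀ e, m⁻¹ ≤ f e := by
    intro e
    simp only [hf, Pi.smul_apply, Finset.sum_apply, smul_eq_mul]
    refine le_mul_of_one_le_right (by positivity) ?_
    calc (1 : ℝ) ≤ b e e := by exact_mod_cast hbpos e
      _ ≤ _ := single_le_sum (f := fun i => (b i e : ℝ)) (fun _ _ => by positivity) (mem_univ e)
  have hfn : H.netflow f = fun v => (unitNetflow n v : ℝ) := by
    rw [hf, map_smul, map_sum]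
    simp only [netflow_natCast, hb, sum_const, card_univ, ← Nat.cast_smul_eq_nsmul ℝ]
    rw [← hm, inv_smul_smul₀ hm0.ne']
  -- Every coordinate of `f` is at least `m⁻¹`, so moving by `ε • g` keeps it nonnegative.
  set ε : ℝ := m⁻¹ / (‖g‖ + 1) with hε
  have hε0 : 0 < ε := by positivity
  have hfP : f ∈ H.flowPolytope (unitNetflow n) :=
    (H.mem_flowPolytope).2 ⟨fun e => (inv_pos.2 hm0).le.trans (hfm e), hfn⟩
  have hfgP : f + ε • g ∈ H.flowPolytope (unitNetflow n) := by
    refine (H.mem_flowPolytope).2 ⟨fun e => ?_, ?_⟩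
    · have h1 : |g e| ≤ ‖g‖ := norm_le_pi_norm g e
      have h2 : ε * (‖g‖ + 1) = m⁻¹ := div_mul_cancel₀ _ (by positivity)
      have h3 := hfm e
      have h4 := neg_abs_le (g e)
      have h5 : ε * (-(‖g‖ + 1)) ≤ ε * g e := mul_le_mul_of_nonneg_left (by linarith) hε0.le
      simp only [Pi.add_apply, Pi.smul_apply, smul_eq_mul]
      linarith
    · rw [map_add, hfn, map_smul, LinearMap.mem_ker.1 hg, smul_zero, add_zero]
  have hmem := vsub_mem_vectorSpan ℝ hfgP hfP
  rw [vsub_eq_sub, add_sub_cancel_left] at hmem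
  simpa [smul_smul, hε0.ne'] using Submodule.smul_mem _ ε⁻¹ hmem

/-- The lattice points of the `t`-th dilate of the unit flow polytope are the natural flows of
size `t`. -/
theorem card_flowPolytope_inter_lattice {b₀ : E → ℕ}
    (hb₀ : ∑ e, b₀ e • H.root e = unitNetflow n) {t : ℕ} (ht : t ≠ 0) :
    Nat.card ({v : LinearMap.ker H.netflow |
        (fun e => (b₀ e : ℝ)) + (v : E → ℝ) ∈ H.flowPolytope (unitNetflow n)} ∩
      (t : ℝ)⁻¹ • (integerLattice (LinearMap.ker H.netflow) : Set (LinearMap.ker H.netflow)) :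
        Set (LinearMap.ker H.netflow)) = H.kostant (t • unitNetflow n) := by
  have ht' : (t : ℝ) ≠ 0 := Nat.cast_ne_zero.2 ht
  set p : E → ℝ := fun e => (b₀ e : ℝ) with hp
  have hpn : H.netflow p = fun v => (unitNetflow n v : ℝ) := by rw [hp, netflow_natCast, hb₀]
  have hbn : ∀ b ∈ H.kostantSet (t • unitNetflow n), H.netflow (fun e => (b e : ℝ))
      = (t : ℝ) • fun v => (unitNetflow n v : ℝ) := by
    intro b hb
    have hb : ∑ e, b e • H.root e = t • unitNetflow n := hb
    rw [netflow_natCast, hb]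
    ext v
    simp
  rw [kostant, ← Nat.card_coe_set_eq]
  -- A flow of size `t` is scaled down and recentred at `p`. As `p` is integral, `t • F b = b - t •
  -- p` is a lattice vector; the inverse sends `v` to `t • (p + v)`.
  let F : H.kostantSet (t • unitNetflow n) → LinearMap.ker H.netflow := fun b =>
    ⟨(t : ℝ)⁻¹ • (fun e => (b.1 e : ℝ)) - p, by
      rw [LinearMap.mem_ker, map_sub, map_smul, hbn b.1 b.2, hpn, inv_smul_smul₀ ht', sub_self]⟩
  symm
  refine Nat.card_congr (Equiv.ofBijective (fun b => ⟨F b, ?_, ?_⟩) ⟨?_, ?_⟩)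
  · refine (H.mem_flowPolytope).2 ⟨fun e => ?_, ?_⟩
    · simp only [F, add_sub_cancel, Pi.smul_apply, smul_eq_mul]
      positivity
    · simp only [F, add_sub_cancel, map_smul]
      rw [hbn b.1 b.2, inv_smul_smul₀ ht']
  · rw [Set.mem_inv_smul_set_iff₀ ht']
    intro e
    refine ⟨b.1 e - t * b₀ e, ?_⟩
    simp only [F, Submodule.coe_smul, Pi.smul_apply, Pi.sub_apply, smul_eq_mul, hp, mul_sub,
      mul_inv_cancel_left₀ ht']
    push_cast
    ring
  · intro b c hbc
    have h1 : F b = F c := congrArg (fun x => x.1) hbc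
    have h2 := congrArg (fun x : LinearMap.ker H.netflow => (x : E → ℝ)) h1
    refine Subtype.ext (funext fun e => ?_)
    have h3 := congrFun h2 e
    simpa [F, ht'] using h3
  · rintro ⟨v, hv, hvL⟩
    rw [Set.mem_inv_smul_set_iff₀ ht'] at hvL
    have hv := (H.mem_flowPolytope).1 hv
    choose k hk using hvL
    have hk : ∀ e, (t : ℝ) * (v : E → ℝ) e = k e := hk
    have hnonneg : ∀ e, 0 ≤ t * (b₀ e : ℤ) + k e := by
      intro e
      have : (0 : ℝ) ≤ t * (b₀ e : ℝ) + k e := by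
        rw [← hk, ← mul_add]
        exact mul_nonneg (Nat.cast_nonneg t) (hv.1 e)
      exact_mod_cast this
    have hcast : ∀ e, (((t * (b₀ e : ℤ) + k e).toNat : ℕ) : ℝ) = t * (p e + (v : E → ℝ) e) := by
      intro e
      have := congrArg (Int.cast (R := ℝ)) (Int.toNat_of_nonneg (hnonneg e))
      rw [Int.cast_natCast] at this
      rw [this, mul_add, hk]
      simp [hp]
    have hfun : (fun e => (((t * (b₀ e : ℤ) + k e).toNat : ℕ) : ℝ)) = (t : ℝ) • (p + (v : E → ℝ)) :=
      funext hcast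
    refine ⟨⟨fun e => (t * (b₀ e : ℤ) + k e).toNat, ?_⟩, ?_⟩
    · show _ = _
      ext u
      have h1 := congrFun (H.netflow_natCast fun e => (t * (b₀ e : ℤ) + k e).toNat) u
      rw [hfun, map_smul, hv.2] at h1
      have h2 : ((t * unitNetflow n u : ℤ) : ℝ)
          = ((∑ e, (t * (b₀ e : ℤ) + k e).toNat • H.root e) u : ℤ) := by
        rw [← h1]
        simp
      have h3 := Int.cast_injective h2
      rw [← h3]
      simp
    · refine Subtype.ext (Subtype.ext ?_)
      change (t : ℝ)⁻¹ • (fun e => (((t * (b₀ e : ℤ) + k e).toNat : ℕ) : ℝ)) - p = v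
      rw [hfun, inv_smul_smul₀ ht', add_sub_cancel_left]

/-- For the sink, connectivity supplies an incident edge, which must enter it because no vertex is
larger. -/
theorem inEdges_nonempty (hconn : H.Connected) (hn : 1 ≤ n)
    (hin : ∀ i : Fin (n + 1), 0 < i → i < Fin.last n → 1 ≤ H.indeg i) (j : ℕ) (h1 : 1 ≤ j)
    (hj : j ≤ n) : (H.inEdges j).Nonempty := by
  rcases hj.lt_or_eq with hj | rfl
  · rw [← card_pos]
    have := hin ⟨j, by omega⟩ (Fin.lt_def.2 h1) (Fin.lt_def.2 hj)
    rwa [indeg_eq_card_inEdges] at this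
  · have : Nontrivial (Fin (j + 1)) := Fin.nontrivial_iff_two_le.2 (by omega)
    obtain ⟨v, hv⟩ := hconn.preconnected.exists_adj_of_nontrivial (Fin.last j)
    rw [SimpleGraph.fromRel_adj] at hv
    obtain ⟨-, ⟨e, he, -⟩ | ⟨e, -, he⟩⟩ := hv
    · have := H.init_lt_fin e
      exact absurd (Fin.le_last (H.fin e)) (not_le.2 (he ▸ this))
    · exact ⟨e, by simp [he]⟩

theorem outEdges_nonempty (hconn : H.Connected) (hn : 1 ≤ n)
    (hout : ∀ i : Fin (n + 1), 0 < i → i < Fin.last n → 1 ≤ H.outdeg i) (j : ℕ) (hj : j < n) :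
    (H.outEdges j).Nonempty := by
  rcases Nat.eq_zero_or_pos j with rfl | h1
  · have : Nontrivial (Fin (n + 1)) := Fin.nontrivial_iff_two_le.2 (by omega)
    obtain ⟨v, hv⟩ := hconn.preconnected.exists_adj_of_nontrivial 0
    rw [SimpleGraph.fromRel_adj] at hv
    obtain ⟨-, ⟨e, he, -⟩ | ⟨e, -, he⟩⟩ := hv
    · exact ⟨e, by simp [he]⟩
    · have := H.init_lt_fin e
      exact absurd (Fin.zero_le (H.init e)) (not_le.2 (he ▸ this))
  · rw [← card_pos]
    have := hout ⟨j, by omega⟩ (Fin.lt_def.2 h1) (Fin.lt_def.2 hj)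
    rwa [outdeg_eq_card_outEdges] at this

/-- Both binomial bounds have leading term `t ^ d / d!`, so the count is squeezed. -/
theorem tendsto_kostant_smul_unitNetflow (hn : 1 ≤ n)
    (hin : ∀ j, 1 ≤ j → j ≤ n → (H.inEdges j).Nonempty)
    (hout : ∀ j, j < n → (H.outEdges j).Nonempty) :
    Tendsto (fun t : ℕ => (H.kostant (t • unitNetflow n) : ℝ) / t ^ (Fintype.card E - n)) atTop
      (𝓝 (H.kostant H.indegVector * ((Fintype.card E - n).factorial : ℝ)⁻¹)) := by
  classical
  set d := Fintype.card E - n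
  have hK : H.kostant H.indegVector = #(H.indegLevel n) := by
    rw [kostant, ← H.coe_indegLevel hn hin, Set.ncard_coe_finset]
  have hN : ∀ t : ℕ, H.kostant (t • unitNetflow n) = #(H.flowLevel t n) := fun t => by
    rw [kostant, ← H.coe_flowLevel, Set.ncard_coe_finset]
  refine tendsto_of_tendsto_of_tendsto_of_le_of_le
    ((tendsto_choose_add_div_pow 0 d).const_mul (H.kostant H.indegVector : ℝ))
    ((tendsto_choose_add_div_pow d d).const_mul (H.kostant H.indegVector : ℝ))
    (fun t => ?_) (fun t => ?_)
  · simp only [zero_add, ← mul_div_assoc]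
    gcongr
    rw [hN, hK]
    exact_mod_cast H.le_card_flowLevel hn hin hout t
  · simp only [← mul_div_assoc]
    gcongr
    rw [hN, hK]
    exact_mod_cast H.card_flowLevel_le hn hin hout t

end LooplessGraph

end

theorem theorem6p1 {n : ℕ} (hn : 1 ≤ n) {E : Type*} [Fintype E] (H : LooplessGraph n E)
    (hconn : H.Connected)
    (hin : ∀ i : Fin (n + 1), 0 < i → i < Fin.last n → 1 ≤ H.indeg i)
    (hout : ∀ i : Fin (n + 1), 0 < i → i < Fin.last n → 1 ≤ H.outdeg i) :
    normalizedVolume (H.flowPolytope (unitNetflow n)) = (H.kostant H.indegVector : ℝ) := by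
  have hin' := H.inEdges_nonempty hconn hn hin
  have hout' := H.outEdges_nonempty hconn hn hout
  have : Nonempty E := ⟨(hout' 0 hn).choose⟩
  obtain ⟨b, hb⟩ := H.exists_flow_to_last hout' 0
  have := H.isZLattice_integerLattice_ker_netflow hout'
  have hd : Module.finrank ℝ (LinearMap.ker H.netflow) = Fintype.card E - n := by
    have := H.finrank_ker_netflow_add hout'
    omega
  have hbP : (fun e => (b e : ℝ)) ∈ H.flowPolytope (unitNetflow n) :=
    H.mem_flowPolytope.2 ⟨fun e => Nat.cast_nonneg _, by rw [H.netflow_natCast, hb]; rfl⟩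
  have hlim := H.tendsto_kostant_smul_unitNetflow hn hin' hout'
  rw [normalizedVolume_eq_of_tendsto (H.vectorSpan_flowPolytope hin' hout') hbP
    (H.isBounded_flowPolytope _) (H.isClosed_flowPolytope _) (H.convex_flowPolytope _)
    (hlim.congr' ?_), hd, mul_left_comm, mul_inv_cancel₀ (by positivity), mul_one]
  -- The dilation by `t⁻¹` is invertible only for `t ≠ 0`, which suffices for the limit.
  filter_upwards [Filter.eventually_ne_atTop 0] with t ht
  rw [hd, H.card_flowPolytope_inter_lattice hb ht]
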